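/- Let $r\ge 0$ and let $W_r$ be the hyperoctahedral group, i.e. the group of permutations $\sigma$ of $\{-r,\dots,-1,1,\dots,r\}$ with $\sigma(-x)=-\sigma(x)$. For $\sigma\in W_r$ let $|\sigma|\in\mathfrak S_r$ be the induced permutation of absolute values and put $\operatorname{sgn}\sigma=(-1)^{\#\{i>0\,:\,\sigma(i)<0\}}\operatorname{sgn}|\sigma|$. Let $K$ be any field (of arbitrary characteristic, $0$ and $2$ included). A bi-partition of $r$ is a pair $\lambda=(\lambda^1,\lambda^2)$ of (possibly empty) partitions with $|\lambda^1|+|\lambda^2|=r$; its conjugate is $\lambda'=((\lambda^{2})',(\lambda^{1})')$. A $\lambda$-bi-tableau $\mathfrak t=(\mathfrak t^1,\mathfrak t^2)$ is a filling of the boxes of the Young diagrams of $\lambda^1$ and $\lambda^2$ by elements of $\{\pm1,\dots,\pm r\}$ such that each of $1,\dots,r$ occurs exactly once up to sign. $W_r$ acts on bi-tableaux through the entries. Let $R_{\mathfrak t}\le W_r$ be the group of elements permuting the entries within each row of $\mathfrak t$ and possibly changing signs of entries of $\mathfrak t^2$, and $C_{\mathfrak t}\le W_r$ the group of elements permuting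 the entries within each column of $\mathfrak t$ and possibly changing signs of entries of $\mathfrak t^1$. The bi-tabloid $\{\mathfrak t\}$ is the class of $\mathfrak t$ modulo $R_{\mathfrak t}$, and $M(\lambda)$ is the $K$-vector space with basis the $\lambda$-bi-tabloids, on which $W_r$ acts by $\sigma\{\mathfrak t\}=\{\sigma\mathfrak t\}$. The Specht module $S(\lambda)\subseteq M(\lambda)$ is the span of all polytabloids $e_{\mathfrak t}=\sum_{\sigma\in C_{\mathfrak t}}\operatorname{sgn}(\sigma)\,\sigma\{\mathfrak t\}$. The dual Specht module $S'(\lambda)$ is $\operatorname{Hom}_K(S(\lambda),K)$ with $(\sigma\varphi)(m)=\varphi(\sigma^{-1}m)$. The sign module is $\operatorname{sgn}:=S\big((1^r),\emptyset\big)$. Then for every bi-partition $\lambda$ of $r$ there is an isomorphism of $KW_r$-modules $$S'(\lambda')\;\cong\; S(\lambda)\otimes_K S\big((1^r),\emptyset\big)=S(\lambda)\otimes_K\operatorname{sgn},$$ where $W_r$ acts diagonally on the tensor product. -/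

import Mathlib

open scoped Pointwise

namespace Hyperoctahedral

/-! ### The hyperoctahedral group -/

/-- The set `{-r, …, -1, 1, …, r}`: the pair `(i, ε)` with `i : Fin r` and `ε = ±1` stands for
the integer `ε * (i + 1)`. -/
abbrev Pt (r : ℕ) : Type := Fin r × ℤˣ

/-- The map `x ↦ -x` of `{-r, …, -1, 1, …, r}`. -/
def negPt {r : ℕ} (x : Pt r) : Pt r := (x.1, -x.2)

/-- The hyperoctahedral group `W_r`: all permutations `σ` of `{-r, …, -1, 1, …, r}` such that
`σ (-x) = - σ x`. -/
def W (r : ℕ) : Subgroup (Equiv.Perm (Pt r)) where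
  carrier := {σ | ∀ x, σ (negPt x) = negPt (σ x)}
  mul_mem' := by
    intro a b ha hb x
    rw [Equiv.Perm.mul_apply, hb x, ha, Equiv.Perm.mul_apply]
  one_mem' := fun _ => rfl
  inv_mem' := by
    intro a ha x
    rw [Equiv.Perm.inv_eq_iff_eq, ha, ← Equiv.Perm.mul_apply, mul_inv_cancel,
      Equiv.Perm.one_apply]

theorem negPt_negPt {r : ℕ} (x : Pt r) : negPt (negPt x) = x := by simp [negPt]

theorem W.smul_negPt {r : ℕ} (σ : W r) (x : Pt r) : σ • negPt x = negPt (σ • x) := σ.2 x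

theorem W.smul_eq {r : ℕ} (σ : W r) (x : Pt r) :
    σ • x = ((σ • ((x.1, 1) : Pt r)).1, x.2 * (σ • ((x.1, 1) : Pt r)).2) := by
  obtain ⟨i, ε⟩ := x
  rcases Int.units_eq_one_or ε with rfl | rfl
  · simp
  · have h := W.smul_negPt σ ((i, 1) : Pt r)
    rw [show negPt ((i, 1) : Pt r) = (i, -1) from rfl] at h
    rw [h]
    simp [negPt]

theorem W.smul_fst {r : ℕ} (σ : W r) (x : Pt r) :
    (σ • x).1 = (σ • ((x.1, 1) : Pt r)).1 := by
  rw [W.smul_eq]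

/-- The permutation `|σ|` of the absolute values `{1, …, r}` induced by `σ`. -/
def W.abs {r : ℕ} : W r →* Equiv.Perm (Fin r) :=
  MonoidHom.toHomPerm
    { toFun := fun σ i => (σ • ((i, 1) : Pt r)).1
      map_one' := by funext i; simp only [one_smul]; rfl
      map_mul' := by
        intro σ τ
        funext i
        change ((σ * τ) • ((i, 1) : Pt r)).1 = (σ • (((τ • ((i, 1) : Pt r)).1, 1) : Pt r)).1
        rw [mul_smul, W.smul_fst] }

theorem W.abs_apply {r : ℕ} (σ : W r) (i : Fin r) : W.abs σ i = (σ • ((i, 1) : Pt r)).1 := rfl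

/-- The sign of `σ = (∏ ξ_i) |σ|`: the sign of the permutation `|σ|` times `-1` for each sign
change `ξ_i`, that is, for each `i > 0` with `σ i < 0`. -/
def W.sgn {r : ℕ} : W r →* ℤˣ where
  toFun σ := (∏ i : Fin r, (σ • ((i, 1) : Pt r)).2) * Equiv.Perm.sign (W.abs σ)
  map_one' := by simp
  map_mul' := by
    intro σ τ
    have h : ∀ i : Fin r, ((σ * τ) • ((i, 1) : Pt r)).2
        = (τ • ((i, 1) : Pt r)).2 * (σ • ((W.abs τ i, 1) : Pt r)).2 := by
      intro i
      rw [mul_smul, W.smul_eq σ (τ • ((i, 1) : Pt r)), W.abs_apply]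
    simp only [h, Finset.prod_mul_distrib, map_mul]
    rw [Equiv.prod_comp (W.abs τ) (fun j => (σ • ((j, 1) : Pt r)).2)]
    ac_rfl

/-! ### Bi-partitions -/

/-- A bi-partition `(λ¹, λ²)` of `r`: partitions are given by their Young diagrams, in which a
box `(i, j)` lies in row `i` and column `j`. -/
@[ext]
structure BiPartition (r : ℕ) where
  /-- The first component `λ¹`. -/
  fst : YoungDiagram
  /-- The second component `λ²`. -/
  snd : YoungDiagram
  card_add_card : fst.card + snd.card = r

theorem card_transpose (μ : YoungDiagram) : μ.transpose.card = μ.card := by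
  simp [YoungDiagram.card, YoungDiagram.transpose]

/-- The conjugate bi-partition `λ' = (λ²', λ¹')`. -/
def BiPartition.conj {r : ℕ} (l : BiPartition r) : BiPartition r where
  fst := l.snd.transpose
  snd := l.fst.transpose
  card_add_card := by rw [card_transpose, card_transpose, add_comm, l.card_add_card]

/-- The partition `(1^r)`: one column with `r` boxes. -/
def oneColumn (r : ℕ) : YoungDiagram where
  cells := Finset.range r ×ˢ {0}
  isLowerSet := by
    rintro ⟨a, b⟩ ⟨c, d⟩ ⟨h1, h2⟩ h
    simp only [Finset.coe_product, Set.mem_prod, Finset.mem_coe, Finset.mem_range,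
      Finset.mem_singleton] at h ⊢
    simp only at h1 h2
    omega

/-- The bi-partition `((1^r), ∅)`. -/
def signShape (r : ℕ) : BiPartition r where
  fst := oneColumn r
  snd := ⊥
  card_add_card := by simp [YoungDiagram.card, oneColumn]

/-- The boxes of the pair of Young diagrams `(λ¹, λ²)`. -/
abbrev BiPartition.Box {r : ℕ} (l : BiPartition r) : Type :=
  {c : ℕ × ℕ // c ∈ l.fst} ⊕ {c : ℕ × ℕ // c ∈ l.snd}

/-! ### Bi-tableaux -/

/-- A bi-tableau of shape `l`: the boxes are filled with elements of `{-r, …, -1, 1, …, r}` in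
such a way that, up to sign, each of `1, …, r` occurs exactly once. -/
@[ext]
structure BiTableau {r : ℕ} (l : BiPartition r) where
  /-- The entry of a box. -/
  entry : l.Box → Pt r
  bijective : Function.Bijective fun b => (entry b).1

namespace BiTableau

variable {r : ℕ} {l : BiPartition r}

/-- `W_r` acts on bi-tableaux through their entries. -/
instance : MulAction (W r) (BiTableau l) where
  smul σ t :=
    { entry := fun b => σ • t.entry b
      bijective := by
        have h : (fun b => (σ • t.entry b).1) = W.abs σ ∘ fun b => (t.entry b).1 := by
          funext b
          exact W.smul_fst σ (t.entry b)
        rw [h]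
        exact (W.abs σ).bijective.comp t.bijective }
  one_smul t := by
    ext1
    funext b
    exact one_smul _ _
  mul_smul σ τ t := by
    ext1
    funext b
    exact mul_smul _ _ _

theorem smul_entry (σ : W r) (t : BiTableau l) (b : l.Box) :
    (σ • t).entry b = σ • t.entry b := rfl

/-- The entries of `t` in row `i` of the first tableau. -/
def row₁ (t : BiTableau l) (i : ℕ) : Set (Pt r) :=
  {x | ∃ c, c.1.1 = i ∧ x = t.entry (.inl c)}

/-- The entries of `t` in row `i` of the second tableau, together with their negatives. -/
def row₂ (t : BiTableau l) (i : ℕ) : Set (Pt r) :=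
  {x | ∃ c, c.1.1 = i ∧ (x = t.entry (.inr c) ∨ x = negPt (t.entry (.inr c)))}

/-- The entries of `t` in column `j` of the first tableau, together with their negatives. -/
def col₁ (t : BiTableau l) (j : ℕ) : Set (Pt r) :=
  {x | ∃ c, c.1.2 = j ∧ (x = t.entry (.inl c) ∨ x = negPt (t.entry (.inl c)))}

/-- The entries of `t` in column `j` of the second tableau. -/
def col₂ (t : BiTableau l) (j : ℕ) : Set (Pt r) :=
  {x | ∃ c, c.1.2 = j ∧ x = t.entry (.inr c)}

/-- The group `R_t` of row permutations: the elements of `W_r` that permute the entries within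
each row of `t`, and may change the sign of the entries of the second tableau. -/
def rowGroup (t : BiTableau l) : Subgroup (W r) :=
  (⨅ i, MulAction.stabilizer (W r) (t.row₁ i)) ⊓ (⨅ i, MulAction.stabilizer (W r) (t.row₂ i))

/-- The group `C_t` of column permutations: the elements of `W_r` that permute the entries within
each column of `t`, and may change the sign of the entries of the first tableau. -/
def colGroup (t : BiTableau l) : Subgroup (W r) :=
  (⨅ j, MulAction.stabilizer (W r) (t.col₁ j)) ⊓ (⨅ j, MulAction.stabilizer (W r) (t.col₂ j))

theorem mem_rowGroup {t : BiTableau l} {σ : W r} :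
    σ ∈ t.rowGroup ↔ (∀ i, σ • t.row₁ i = t.row₁ i) ∧ ∀ i, σ • t.row₂ i = t.row₂ i := by
  simp only [rowGroup, Subgroup.mem_inf, Subgroup.mem_iInf, MulAction.mem_stabilizer_iff]

theorem mem_colGroup {t : BiTableau l} {σ : W r} :
    σ ∈ t.colGroup ↔ (∀ j, σ • t.col₁ j = t.col₁ j) ∧ ∀ j, σ • t.col₂ j = t.col₂ j := by
  simp only [colGroup, Subgroup.mem_inf, Subgroup.mem_iInf, MulAction.mem_stabilizer_iff]

theorem row₁_smul (σ : W r) (t : BiTableau l) (i : ℕ) : (σ • t).row₁ i = σ • t.row₁ i := by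
  ext x
  simp only [row₁, Set.mem_smul_set_iff_inv_smul_mem, Set.mem_ofPred_eq, smul_entry,
    inv_smul_eq_iff]

theorem row₂_smul (σ : W r) (t : BiTableau l) (i : ℕ) : (σ • t).row₂ i = σ • t.row₂ i := by
  ext x
  simp only [row₂, Set.mem_smul_set_iff_inv_smul_mem, Set.mem_ofPred_eq, smul_entry,
    inv_smul_eq_iff, W.smul_negPt]

theorem col₁_smul (σ : W r) (t : BiTableau l) (j : ℕ) : (σ • t).col₁ j = σ • t.col₁ j := by
  ext x
  simp only [col₁, Set.mem_smul_set_iff_inv_smul_mem, Set.mem_ofPred_eq, smul_entry,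
    inv_smul_eq_iff, W.smul_negPt]

theorem col₂_smul (σ : W r) (t : BiTableau l) (j : ℕ) : (σ • t).col₂ j = σ • t.col₂ j := by
  ext x
  simp only [col₂, Set.mem_smul_set_iff_inv_smul_mem, Set.mem_ofPred_eq, smul_entry,
    inv_smul_eq_iff]

theorem mem_rowGroup_smul {t : BiTableau l} {σ τ : W r} :
    τ ∈ (σ • t).rowGroup ↔ σ⁻¹ * τ * σ ∈ t.rowGroup := by
  simp only [mem_rowGroup, row₁_smul, row₂_smul, mul_smul, inv_smul_eq_iff]

theorem mem_colGroup_smul {t : BiTableau l} {σ τ : W r} :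
    τ ∈ (σ • t).colGroup ↔ σ⁻¹ * τ * σ ∈ t.colGroup := by
  simp only [mem_colGroup, col₁_smul, col₂_smul, mul_smul, inv_smul_eq_iff]

/-- Two bi-tableaux are equivalent if they differ by a row permutation. -/
instance rowSetoid (l : BiPartition r) : Setoid (BiTableau l) where
  r t₁ t₂ := ∃ σ ∈ t₁.rowGroup, t₂ = σ • t₁
  iseqv :=
    { refl := fun t => ⟨1, one_mem _, (one_smul _ _).symm⟩
      symm := by
        rintro t₁ _ ⟨σ, hσ, rfl⟩
        refine ⟨σ⁻¹, ?_, (inv_smul_smul _ _).symm⟩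
        rw [mem_rowGroup_smul]
        simpa using hσ
      trans := by
        rintro t₁ _ _ ⟨σ, hσ, rfl⟩ ⟨τ, hτ, rfl⟩
        refine ⟨τ * σ, ?_, (mul_smul _ _ _).symm⟩
        rw [mem_rowGroup_smul] at hτ
        simpa [mul_assoc] using mul_mem hσ hτ }

theorem equiv_iff {t₁ t₂ : BiTableau l} : t₁ ≈ t₂ ↔ ∃ σ ∈ t₁.rowGroup, t₂ = σ • t₁ := Iff.rfl

theorem smul_equiv_smul (σ : W r) {t₁ t₂ : BiTableau l} (h : t₁ ≈ t₂) : σ • t₁ ≈ σ • t₂ := by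
  obtain ⟨τ, hτ, rfl⟩ := h
  refine ⟨σ * τ * σ⁻¹, ?_, ?_⟩
  · rw [mem_rowGroup_smul]
    simpa [mul_assoc] using hτ
  · simp [mul_smul]

end BiTableau

/-! ### Permutation modules and Specht modules -/

/-- The bi-tabloids of shape `l`: row equivalence classes `{t}` of bi-tableaux. -/
abbrev BiTabloid {r : ℕ} (l : BiPartition r) : Type := Quotient (BiTableau.rowSetoid l)

/-- The action `σ {t} = {σ t}` on bi-tabloids. -/
instance {r : ℕ} (l : BiPartition r) : MulAction (W r) (BiTabloid l) where
  smul σ := Quotient.map (σ • ·) fun _ _ h => BiTableau.smul_equiv_smul σ h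
  one_smul := by
    rintro ⟨t⟩
    exact congrArg (Quotient.mk _) (one_smul _ t)
  mul_smul σ τ := by
    rintro ⟨t⟩
    exact congrArg (Quotient.mk _) (mul_smul σ τ t)

section

variable (K : Type*) [Field K] {r : ℕ} {l : BiPartition r}

/-- The permutation module `M(l)`: the `K`-vector space with the bi-tabloids as basis, on which
`W_r` acts by permuting the basis. -/
noncomputable def permModule (l : BiPartition r) :
    Representation K (W r) (MonoidAlgebra K (BiTabloid l)) :=
  Representation.ofMulAction K (W r) (BiTabloid l)

/-- The bi-tabloid `{t}` as an element of `M(l)`. -/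
noncomputable def tabloid (t : BiTableau l) : MonoidAlgebra K (BiTabloid l) :=
  MonoidAlgebra.single (Quotient.mk _ t) 1

open scoped Classical in
/-- The alternating column sum `k_t = ∑_{σ ∈ C_t} sgn(σ) σ` in the group algebra. -/
noncomputable def columnSum (t : BiTableau l) : MonoidAlgebra K (W r) :=
  ∑ σ : t.colGroup, MonoidAlgebra.single (σ : W r) (((W.sgn (σ : W r) : ℤˣ) : ℤ) : K)

/-- The polytabloid `e_t`, obtained by applying `k_t` to `{t}`. -/
noncomputable def polytabloid (t : BiTableau l) : MonoidAlgebra K (BiTabloid l) :=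
  (permModule K l).asAlgebraHom (columnSum K t) (tabloid K t)

theorem permModule_tabloid (σ : W r) (t : BiTableau l) :
    permModule K l σ (tabloid K t) = tabloid K (σ • t) := by
  simp only [permModule, tabloid, Representation.ofMulAction_single]
  rfl

open scoped Classical in
theorem polytabloid_eq (t : BiTableau l) :
    polytabloid K t = ∑ σ : t.colGroup,
      (((W.sgn (σ : W r) : ℤˣ) : ℤ) : K) • tabloid K ((σ : W r) • t) := by
  simp [polytabloid, columnSum, permModule_tabloid]

theorem permModule_polytabloid (σ : W r) (t : BiTableau l) :
    permModule K l σ (polytabloid K t) = polytabloid K (σ • t) := by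
  classical
  simp only [polytabloid_eq, map_sum, map_smul, permModule_tabloid]
  refine Finset.sum_bij'
    (fun τ _ => ⟨σ * (τ : W r) * σ⁻¹, by
      rw [BiTableau.mem_colGroup_smul]; simp [mul_assoc]⟩)
    (fun τ _ => ⟨σ⁻¹ * (τ : W r) * σ, BiTableau.mem_colGroup_smul.1 τ.2⟩) ?_ ?_ ?_ ?_ ?_
  · simp
  · simp
  · intro τ _
    ext1
    simp [mul_assoc]
  · intro τ _
    ext1
    simp [mul_assoc]
  · intro τ _
    have h : W.sgn (σ * (τ : W r) * σ⁻¹) = W.sgn (τ : W r) := by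
      rw [map_mul, map_mul, map_inv, mul_comm (W.sgn σ), mul_inv_cancel_right]
    simp only [h, mul_smul, inv_smul_smul]

/-- The Specht module `S(l)` as a submodule of `M(l)`: the span of all polytabloids. -/
noncomputable def spechtSub (l : BiPartition r) : Subrepresentation (permModule K l) where
  toSubmodule := Submodule.span K (Set.range (polytabloid K (l := l)))
  apply_mem_toSubmodule := by
    intro σ v hv
    induction hv using Submodule.span_induction with
    | mem x hx =>
      obtain ⟨t, rfl⟩ := hx
      rw [permModule_polytabloid]
      exact Submodule.subset_span ⟨_, rfl⟩
    | zero => rw [map_zero]; exact zero_mem _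
    | add x y _ _ hx hy => rw [map_add]; exact add_mem hx hy
    | smul a x _ hx => rw [map_smul]; exact Submodule.smul_mem _ _ hx

/-- The Specht module `S(l)`. -/
noncomputable def specht (l : BiPartition r) :
    Representation K (W r) (spechtSub K l).toSubmodule :=
  (spechtSub K l).toRepresentation

/-- The dual Specht module `S'(l)`, with `(σ φ)(m) = φ (σ⁻¹ m)`. -/
noncomputable def dualSpecht (l : BiPartition r) :
    Representation K (W r) (Module.Dual K (spechtSub K l).toSubmodule) :=
  (specht K l).dual

end

end Hyperoctahedral

/-! The argument is that of James for the symmetric group. Transposing and exchanging the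
components of a bi-tableau `t` gives a bi-tableau `t'` of shape `λ'`, and this exchanges row and
column groups. Since `e_{t'}` is multiplied by `sgn σ` when `t` is moved by `σ ∈ R_t = C_{t'}`,
there is a surjection `θ : M(λ) → S(λ') ⊗ sgn` with `{t} ↦ ± e_{t'}`. For the bilinear forms with
orthonormal bi-tabloids one finds `⟨{t'}, θ v⟩ = ± ⟨v, e_t⟩`, so the kernel of `θ` is the orthogonal
complement of `S(λ)`. That is also the kernel of the surjection `M(λ) → S'(λ)` given by the form,
whence `S'(λ) ≅ S(λ') ⊗ sgn`, over any field. Finally `S((1^r), ∅)` is a line on which `W_r` acts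
through `sgn`, because `C_t = W_r` for this shape. -/

namespace Hyperoctahedral

section Twist

variable {k G S V V' V'' : Type*} [CommRing k] [Monoid G]
  [AddCommGroup V] [Module k V] [AddCommGroup V'] [Module k V'] [AddCommGroup V''] [Module k V'']
  {ρ : Representation k G V} {ρ' : Representation k G V'} {ρ'' : Representation k G V''}

/-- The twist `g ↦ χ g • ρ g` of a representation by a character `χ`. The values of `χ` are only
required to act on the underlying module, so that characters to `ℤˣ` need not be cast to `k`. -/
def twist [Monoid S] [DistribMulAction S V] [SMulCommClass k S V]
    [LinearMap.CompatibleSMul V V S k] (χ : G →* S) (ρ : Representation k G V) :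
    Representation k G V where
  toFun g := χ g • ρ g
  map_one' := by ext; simp
  map_mul' g h := by ext; simp [mul_smul]

theorem twist_apply [Monoid S] [DistribMulAction S V] [SMulCommClass k S V]
    [LinearMap.CompatibleSMul V V S k] (χ : G →* S) (g : G) (v : V) :
    twist χ ρ g v = χ g • ρ g v := rfl

/-- Tensoring with a one-dimensional representation on which `G` acts through `χ` is the same as
twisting by `χ`; here `v` goes to `v ⊗ u`. -/
noncomputable def twistEquivTprod [Monoid S] [DistribMulAction S V] [SMulCommClass k S V]
    [LinearMap.CompatibleSMul V V S k] [DistribMulAction S V']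
    [TensorProduct.CompatibleSMul k S V V'] {χ : G →* S} {u : V'}
    (hu : Function.Bijective (LinearMap.toSpanSingleton k V' u)) (hχ : ∀ g, ρ' g u = χ g • u) :
    (twist χ ρ).Equiv (ρ.tprod ρ') :=
  .mk ((TensorProduct.rid k V).symm ≪≫ₗ (LinearEquiv.ofBijective _ hu).lTensor V) fun g => by
    ext v
    simp [twist_apply, hχ, TensorProduct.smul_tmul]

theorem nonempty_equiv_of_eq_zero_iff (f : ρ.IntertwiningMap ρ') (g : ρ.IntertwiningMap ρ'')
    (hf : Function.Surjective f) (hg : Function.Surjective g) (hfg : ∀ v, f v = 0 ↔ g v = 0) :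
    Nonempty (ρ'.Equiv ρ'') := by
  have hker : LinearMap.ker f.toLinearMap = LinearMap.ker g.toLinearMap := Submodule.ext hfg
  let e : V' ≃ₗ[k] V'' := (f.toLinearMap.quotKerEquivOfSurjective hf).symm ≪≫ₗ
    Submodule.quotEquivOfEq _ _ hker ≪≫ₗ g.toLinearMap.quotKerEquivOfSurjective hg
  have he (v : V) : e (f v) = g v := by
    have hv := f.toLinearMap.quotKerEquivOfSurjective_symm_apply hf v
    rw [f.toLinearMap_apply] at hv
    simp only [e, LinearEquiv.trans_apply, hv,
      Submodule.quotEquivOfEq_mk, LinearMap.quotKerEquivOfSurjective_apply_mk, g.toLinearMap_apply]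
  refine ⟨.mk e fun a => LinearMap.ext fun w => ?_⟩
  obtain ⟨v, rfl⟩ := hf w
  calc e (ρ' a (f v)) = g (ρ a v) := by rw [← f.isIntertwining, he]
    _ = ρ'' a (e (f v)) := by rw [g.isIntertwining, he]

end Twist

variable {r : ℕ} {l : BiPartition r}

theorem BiPartition.conj_conj (l : BiPartition r) : l.conj.conj = l := by
  ext1 <;> exact YoungDiagram.transpose_transpose _

/-- The reflection in the main diagonal, as a bijection between the boxes of a Young diagram and
those of its transpose. -/
def transposeBox (μ : YoungDiagram) : {c // c ∈ μ.transpose} ≃ {c // c ∈ μ} :=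
  (Equiv.prodComm ℕ ℕ).subtypeEquiv fun _ => YoungDiagram.mem_transpose

/-- The bijection between the boxes of `λ'` and those of `λ` that underlies conjugation of
bi-tableaux. -/
def BiPartition.conjBox (l : BiPartition r) : l.conj.Box ≃ l.Box :=
  ((transposeBox l.snd).sumCongr (transposeBox l.fst)).trans (Equiv.sumComm _ _)

instance (μ : YoungDiagram) : Finite {c // c ∈ μ} :=
  inferInstanceAs (Finite {c // c ∈ μ.cells})

theorem BiPartition.card_box (l : BiPartition r) : Nat.card l.Box = r := by
  have card_boxes (μ : YoungDiagram) : Nat.card {c // c ∈ μ} = μ.card :=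
    Nat.subtype_card μ.cells YoungDiagram.mem_cells
  rw [Nat.card_sum, card_boxes, card_boxes, l.card_add_card]

namespace BiTableau

variable {t : BiTableau l} {σ : W r}

instance : Nonempty (BiTableau l) := by
  let e : l.Box ≃ Fin r := Finite.equivFinOfCardEq l.card_box
  exact ⟨⟨fun b => (e b, 1), e.bijective⟩⟩

theorem fst_entry_injective (t : BiTableau l) : Function.Injective fun b => (t.entry b).1 :=
  t.bijective.injective

theorem exists_eq_entry_or_eq_negPt (t : BiTableau l) (x : Pt r) :
    ∃ b, x = t.entry b ∨ x = negPt (t.entry b) := by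
  obtain ⟨b, hb⟩ := t.bijective.surjective x.1
  have units_eq_or_eq_neg : ∀ u v : ℤˣ, u = v ∨ u = -v := by decide
  exact ⟨b, (units_eq_or_eq_neg x.2 (t.entry b).2).imp (Prod.ext hb.symm) (Prod.ext hb.symm)⟩

/-- The identification of `{-r, …, -1, 1, …, r}` with the signed boxes of a bi-tableau: `(b, ε)`
stands for `ε` times the entry of `b`. -/
noncomputable def signedBoxEquiv (t : BiTableau l) : l.Box × ℤˣ ≃ Pt r :=
  (Equiv.ofBijective _ t.bijective).prodShear fun b => Equiv.mulRight (t.entry b).2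

theorem signedBoxEquiv_one (t : BiTableau l) (b : l.Box) : t.signedBoxEquiv (b, 1) = t.entry b := by
  simp [signedBoxEquiv]

theorem signedBoxEquiv_neg (t : BiTableau l) (b : l.Box) (ε : ℤˣ) :
    t.signedBoxEquiv (b, -ε) = negPt (t.signedBoxEquiv (b, ε)) := by
  simp [signedBoxEquiv, negPt]

instance : MulAction.IsPretransitive (W r) (BiTableau l) where
  exists_smul_eq s t := by
    let σ : Equiv.Perm (Pt r) := s.signedBoxEquiv.symm.trans t.signedBoxEquiv
    have hσ (p : l.Box × ℤˣ) : σ (s.signedBoxEquiv p) = t.signedBoxEquiv p := by simp [σ]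
    have hσW : σ ∈ W r := fun x => by
      obtain ⟨⟨b, ε⟩, rfl⟩ := s.signedBoxEquiv.surjective x
      rw [← signedBoxEquiv_neg, hσ, hσ, signedBoxEquiv_neg]
    refine ⟨⟨σ, hσW⟩, BiTableau.ext (funext fun b => ?_)⟩
    rw [smul_entry, ← signedBoxEquiv_one, ← signedBoxEquiv_one]
    exact hσ (b, 1)

theorem eq_one_of_smul_eq_self (h : σ • t = t) : σ = 1 := by
  have fixes_entry (b : l.Box) : σ • t.entry b = t.entry b := congrArg (entry · b) h
  refine Subtype.ext (Equiv.ext fun x => ?_)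
  change σ • x = x
  obtain ⟨b, rfl | rfl⟩ := t.exists_eq_entry_or_eq_negPt x
  · exact fixes_entry b
  · rw [W.smul_negPt, fixes_entry]

theorem smul_left_injective (t : BiTableau l) : Function.Injective fun σ : W r => σ • t :=
  fun σ τ h => inv_mul_eq_one.1 <| eq_one_of_smul_eq_self (t := t) <| by
    rw [mul_smul, inv_smul_eq_iff]; exact h.symm

/-- The sign `sgn σ` of the unique `σ ∈ W_r` that carries the reference bi-tableau `t₀` to `t`. -/
noncomputable def relSign (t₀ t : BiTableau l) : ℤˣ :=
  W.sgn (MulAction.exists_smul_eq (W r) t₀ t).choose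

theorem relSign_smul (t₀ t : BiTableau l) (σ : W r) :
    relSign t₀ (σ • t) = W.sgn σ * relSign t₀ t := by
  rw [relSign, relSign, ← map_mul]
  refine congrArg W.sgn (smul_left_injective t₀ ?_)
  simp only [mul_smul, Exists.choose_spec (MulAction.exists_smul_eq _ _ _)]

theorem equiv_smul_iff : t ≈ σ • t ↔ σ ∈ t.rowGroup :=
  ⟨fun ⟨_, hτ, h⟩ => smul_left_injective t h ▸ hτ, fun h => ⟨σ, h, rfl⟩⟩

/-- The conjugate bi-tableau: both components are transposed and then exchanged. -/
def conj (t : BiTableau l) : BiTableau l.conj where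
  entry b := t.entry (l.conjBox b)
  bijective := t.bijective.comp l.conjBox.bijective

theorem conj_smul (σ : W r) (t : BiTableau l) : (σ • t).conj = σ • t.conj := rfl

theorem conj_surjective : Function.Surjective (conj (l := l)) := fun t =>
  ⟨⟨t.entry ∘ l.conjBox.symm, t.bijective.comp l.conjBox.symm.bijective⟩, by ext1; simp [conj]⟩

theorem row₁_conj (t : BiTableau l) (i : ℕ) : t.conj.row₁ i = t.col₂ i :=
  Set.ext fun _ => (transposeBox l.snd).exists_congr fun _ => Iff.rfl

theorem row₂_conj (t : BiTableau l) (i : ℕ) : t.conj.row₂ i = t.col₁ i :=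
  Set.ext fun _ => (transposeBox l.fst).exists_congr fun _ => Iff.rfl

theorem col₁_conj (t : BiTableau l) (j : ℕ) : t.conj.col₁ j = t.row₂ j :=
  Set.ext fun _ => (transposeBox l.snd).exists_congr fun _ => Iff.rfl

theorem col₂_conj (t : BiTableau l) (j : ℕ) : t.conj.col₂ j = t.row₁ j :=
  Set.ext fun _ => (transposeBox l.fst).exists_congr fun _ => Iff.rfl

theorem rowGroup_conj (t : BiTableau l) : t.conj.rowGroup = t.colGroup := by
  ext σ
  simp only [mem_rowGroup, mem_colGroup, row₁_conj, row₂_conj, and_comm]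

theorem colGroup_conj (t : BiTableau l) : t.conj.colGroup = t.rowGroup := by
  ext σ
  simp only [mem_rowGroup, mem_colGroup, col₁_conj, col₂_conj, and_comm]

theorem smul_entry_inl_eq_self (hrow : σ ∈ t.rowGroup) (hcol : σ ∈ t.colGroup)
    (c : {c // c ∈ l.fst}) : σ • t.entry (.inl c) = t.entry (.inl c) := by
  obtain ⟨d, hd, hσd⟩ : σ • t.entry (.inl c) ∈ t.row₁ c.1.1 :=
    (mem_rowGroup.1 hrow).1 c.1.1 ▸ Set.smul_mem_smul_set ⟨c, rfl, rfl⟩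
  obtain ⟨d', hd', hσd'⟩ : σ • t.entry (.inl c) ∈ t.col₁ c.1.2 :=
    (mem_colGroup.1 hcol).1 c.1.2 ▸ Set.smul_mem_smul_set ⟨c, rfl, .inl rfl⟩
  have hfst : (t.entry (.inl d)).1 = (t.entry (.inl d')).1 := by
    rw [← hσd]
    exact hσd'.elim (congrArg Prod.fst) (congrArg Prod.fst)
  have hdd' : d = d' := Sum.inl_injective (t.fst_entry_injective hfst)
  have hdc : d = c := Subtype.ext (Prod.ext hd (hdd' ▸ hd'))
  rw [hσd, hdc]

theorem rowGroup_inf_colGroup (t : BiTableau l) : t.rowGroup ⊓ t.colGroup = ⊥ := by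
  refine eq_bot_iff.2 fun σ ⟨hrow, hcol⟩ => eq_one_of_smul_eq_self (t := t) ?_
  refine BiTableau.ext (funext fun b => ?_)
  obtain c | c := b
  · exact smul_entry_inl_eq_self hrow hcol c
  · have hrow' : σ ∈ t.conj.rowGroup := t.rowGroup_conj ▸ hcol
    have hcol' : σ ∈ t.conj.colGroup := t.colGroup_conj ▸ hrow
    exact smul_entry_inl_eq_self hrow' hcol' ((transposeBox l.snd).symm c)

theorem colGroup_signShape (t : BiTableau (signShape r)) : t.colGroup = ⊤ := by
  have col_eq_zero (c : {c // c ∈ (signShape r).fst}) : c.1.2 = 0 :=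
    Finset.mem_singleton.1 (Finset.mem_product.1 c.2).2
  have col₁_zero : t.col₁ 0 = Set.univ := Set.eq_univ_of_forall fun x => by
    obtain ⟨c | c, hc⟩ := t.exists_eq_entry_or_eq_negPt x
    · exact ⟨c, col_eq_zero c, hc⟩
    · exact (YoungDiagram.notMem_bot _ c.2).elim
  have col₁_eq_empty (j : ℕ) (hj : j ≠ 0) : t.col₁ j = ∅ :=
    Set.eq_empty_of_forall_notMem fun _ ⟨c, hc, _⟩ => hj (hc.symm.trans (col_eq_zero c))
  have col₂_eq_empty (j : ℕ) : t.col₂ j = ∅ :=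
    Set.eq_empty_of_forall_notMem fun _ ⟨c, _⟩ => YoungDiagram.notMem_bot _ c.2
  refine eq_top_iff.2 fun σ _ => mem_colGroup.2 ⟨fun j => ?_, fun j => ?_⟩
  · obtain rfl | hj := eq_or_ne j 0
    · rw [col₁_zero, Set.smul_set_univ]
    · rw [col₁_eq_empty j hj, Set.smul_set_empty]
  · rw [col₂_eq_empty, Set.smul_set_empty]

end BiTableau

variable (K : Type*) [Field K]

/-- The basis of `M(λ)` that consists of the bi-tabloids. -/
noncomputable def tabloidBasis (l : BiPartition r) :
    Module.Basis (BiTabloid l) K (MonoidAlgebra K (BiTabloid l)) :=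
  .ofRepr (MonoidAlgebra.coeffLinearEquiv K)

theorem tabloidBasis_mk (t : BiTableau l) : tabloidBasis K l (Quotient.mk _ t) = tabloid K t := rfl

open scoped Classical in
/-- The bilinear form on `M(λ)` for which the bi-tabloids are orthonormal. -/
noncomputable def tabloidForm (l : BiPartition r) :
    LinearMap.BilinForm K (MonoidAlgebra K (BiTabloid l)) :=
  (tabloidBasis K l).toDual

open scoped Classical in
theorem tabloidForm_tabloid (s t : BiTableau l) :
    tabloidForm K l (tabloid K s) (tabloid K t) = if s ≈ t then 1 else 0 := by
  simp only [tabloidForm, ← tabloidBasis_mk, Module.Basis.toDual_apply, Quotient.eq]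

variable {K} in
theorem eq_zero_of_tabloidForm_eq_zero {v : MonoidAlgebra K (BiTabloid l)}
    (hv : ∀ t, tabloidForm K l (tabloid K t) v = 0) : v = 0 := by
  refine (tabloidBasis K l).ext_elem fun T => ?_
  obtain ⟨t, rfl⟩ := Quotient.exists_rep T
  classical
  rw [map_zero, Finsupp.zero_apply, ← hv t, tabloidForm, ← tabloidBasis_mk,
    Module.Basis.toDual_apply_right]

theorem tabloidForm_surjective : Function.Surjective (tabloidForm K l) := by
  classical
  have : Finite (BiTableau l) := Finite.of_injective BiTableau.entry fun _ _ => BiTableau.ext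
  exact LinearMap.range_eq_top.1 (tabloidBasis K l).toDual_range

variable {K} in
theorem linearMap_ext_tabloid {V : Type*} [AddCommGroup V] [Module K V]
    {f g : MonoidAlgebra K (BiTabloid l) →ₗ[K] V} (h : ∀ t, f (tabloid K t) = g (tabloid K t)) :
    f = g :=
  (tabloidBasis K l).ext (Quotient.ind h)

theorem tabloidForm_permModule_left (σ : W r) (u v : MonoidAlgebra K (BiTabloid l)) :
    tabloidForm K l (permModule K l σ u) v = tabloidForm K l u (permModule K l σ⁻¹ v) := by
  suffices h : tabloidForm K l ∘ₗ permModule K l σ =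
      (tabloidForm K l).compl₂ (permModule K l σ⁻¹) from
    LinearMap.congr_fun₂ h u v
  refine linearMap_ext_tabloid fun s => linearMap_ext_tabloid fun t => ?_
  classical
  have equiv_iff : σ • s ≈ t ↔ s ≈ σ⁻¹ • t :=
    ⟨fun h => by simpa using BiTableau.smul_equiv_smul σ⁻¹ h,
      fun h => by simpa using BiTableau.smul_equiv_smul σ h⟩
  simp only [LinearMap.comp_apply, LinearMap.compl₂_apply, permModule_tabloid, tabloidForm_tabloid,
    equiv_iff]

open scoped Classical in
theorem polytabloid_eq_sum_sgn_smul (t : BiTableau l) :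
    polytabloid K t = ∑ σ : W r with σ ∈ t.colGroup, W.sgn σ • tabloid K (σ • t) := by
  rw [polytabloid_eq]
  simp only [Units.smul_def, Int.cast_smul_eq_zsmul]
  exact (Finset.sum_subtype (p := (· ∈ t.colGroup)) _ (fun σ => Finset.mem_filter_univ σ)
    fun σ => (W.sgn σ : ℤ) • tabloid K (σ • t)).symm

theorem polytabloid_smul_of_mem_colGroup {t : BiTableau l} {σ : W r} (hσ : σ ∈ t.colGroup) :
    polytabloid K (σ • t) = W.sgn σ • polytabloid K t := by
  classical
  rw [← permModule_polytabloid, polytabloid_eq_sum_sgn_smul, Finset.smul_sum, map_sum]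
  refine Finset.sum_equiv (Equiv.mulLeft σ) (fun τ => ?_) fun τ _ => ?_
  · simp [mul_mem_cancel_left hσ]
  · rw [LinearMap.map_smul_of_tower, permModule_tabloid, Equiv.coe_mulLeft, map_mul,
      smul_smul (W.sgn σ), ← mul_assoc, Int.units_mul_self, one_mul, mul_smul σ τ t]

open scoped Classical in
theorem tabloidForm_tabloid_polytabloid (s t : BiTableau l) :
    tabloidForm K l (tabloid K s) (polytabloid K t) =
      ∑ σ : W r with σ ∈ t.colGroup ∧ s ≈ σ • t, W.sgn σ • 1 := by
  simp only [polytabloid_eq_sum_sgn_smul, map_sum, LinearMap.map_smul_of_tower,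
    tabloidForm_tabloid, smul_ite, smul_zero, ← Finset.sum_filter, Finset.filter_filter]

theorem tabloidForm_tabloid_polytabloid_self (t : BiTableau l) :
    tabloidForm K l (tabloid K t) (polytabloid K t) = 1 := by
  classical
  have filter_eq : ({σ : W r | σ ∈ t.colGroup ∧ t ≈ σ • t} : Finset (W r)) = {1} := by
    ext σ
    rw [Finset.mem_filter_univ, BiTableau.equiv_smul_iff, and_comm, ← Subgroup.mem_inf,
      BiTableau.rowGroup_inf_colGroup, Subgroup.mem_bot, Finset.mem_singleton]
  rw [tabloidForm_tabloid_polytabloid, filter_eq, Finset.sum_singleton, map_one, one_smul]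

theorem tabloidForm_smul_tabloid_polytabloid (ρ : W r) (t : BiTableau l) :
    tabloidForm K l (tabloid K (ρ • t)) (polytabloid K t) =
      W.sgn ρ • tabloidForm K l.conj (tabloid K t.conj) (polytabloid K (ρ • t).conj) := by
  classical
  rw [tabloidForm_tabloid_polytabloid, tabloidForm_tabloid_polytabloid, Finset.smul_sum]
  -- `τ ↦ τ * ρ` matches the index sets of the two sums, since conjugation exchanges `R` and `C`.
  refine (Finset.sum_equiv (Equiv.mulRight ρ) (fun τ => ?_) fun τ _ => ?_).symm
  · have hcol : τ ∈ (ρ • t).conj.colGroup ↔ ρ • t ≈ (τ * ρ) • t := by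
      rw [BiTableau.colGroup_conj, mul_smul, BiTableau.equiv_smul_iff]
    have hrow : t.conj ≈ τ • (ρ • t).conj ↔ τ * ρ ∈ t.colGroup := by
      rw [BiTableau.conj_smul, ← mul_smul, BiTableau.equiv_smul_iff, BiTableau.rowGroup_conj]
    simp only [Finset.mem_filter_univ, Equiv.coe_mulRight, hcol, hrow, and_comm]
  · rw [Equiv.coe_mulRight, map_mul, mul_comm, mul_smul]

/-- The polytabloid `e_t` as an element of the Specht module. -/
noncomputable def spechtPolytabloid (t : BiTableau l) : (spechtSub K l).toSubmodule :=
  ⟨polytabloid K t, Submodule.subset_span ⟨t, rfl⟩⟩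

theorem specht_spechtPolytabloid (σ : W r) (t : BiTableau l) :
    specht K l σ (spechtPolytabloid K t) = spechtPolytabloid K (σ • t) :=
  Subtype.ext (permModule_polytabloid K σ t)

theorem spechtPolytabloid_smul_of_mem_colGroup {t : BiTableau l} {σ : W r}
    (hσ : σ ∈ t.colGroup) :
    spechtPolytabloid K (σ • t) = W.sgn σ • spechtPolytabloid K t :=
  Subtype.ext (polytabloid_smul_of_mem_colGroup K hσ)

theorem spechtPolytabloid_ne_zero (t : BiTableau l) : spechtPolytabloid K t ≠ 0 := fun h => by
  have hform := tabloidForm_tabloid_polytabloid_self K t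
  rw [show polytabloid K t = 0 from congrArg Subtype.val h, map_zero] at hform
  exact zero_ne_one hform

theorem span_spechtPolytabloid :
    Submodule.span K (Set.range (spechtPolytabloid K (l := l))) = ⊤ := by
  refine Submodule.map_injective_of_injective (spechtSub K l).toSubmodule.injective_subtype ?_
  rw [Submodule.map_span, ← Set.range_comp, Submodule.map_subtype_top]
  rfl

theorem toSpanSingleton_spechtPolytabloid_signShape_bijective (t : BiTableau (signShape r)) :
    Function.Bijective (LinearMap.toSpanSingleton K _ (spechtPolytabloid K t)) := by
  refine ⟨LinearMap.ker_eq_bot.1 (LinearMap.ker_toSpanSingleton K (spechtPolytabloid_ne_zero K t)),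
    LinearMap.range_eq_top.1 ?_⟩
  rw [← LinearMap.span_singleton_eq_range, eq_top_iff, ← span_spechtPolytabloid, Submodule.span_le]
  rintro _ ⟨s, rfl⟩
  obtain ⟨σ, rfl⟩ := MulAction.exists_smul_eq (W r) t s
  rw [spechtPolytabloid_smul_of_mem_colGroup K (t.colGroup_signShape ▸ Subgroup.mem_top σ)]
  exact Submodule.smul_of_tower_mem _ _ (Submodule.mem_span_singleton_self _)

theorem nonempty_twist_sgn_equiv_tprod_specht_signShape {V : Type*} [AddCommGroup V] [Module K V]
    (ρ : Representation K (W r) V) :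
    Nonempty ((twist W.sgn ρ).Equiv (ρ.tprod (specht K (signShape r)))) := by
  obtain ⟨t⟩ : Nonempty (BiTableau (signShape r)) := inferInstance
  refine ⟨twistEquivTprod (toSpanSingleton_spechtPolytabloid_signShape_bijective K t) fun σ => ?_⟩
  rw [specht_spechtPolytabloid,
    spechtPolytabloid_smul_of_mem_colGroup K (t.colGroup_signShape ▸ Subgroup.mem_top σ)]

/-- The map `M(λ) → S'(λ)` given by the bilinear form on `M(λ)`. -/
noncomputable def toDualSpecht (l : BiPartition r) :
    (permModule K l).IntertwiningMap (dualSpecht K l) where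
  toLinearMap := (spechtSub K l).toSubmodule.subtype.dualMap ∘ₗ tabloidForm K l
  isIntertwining' σ := LinearMap.ext fun u => LinearMap.ext fun v =>
    tabloidForm_permModule_left K σ u v

theorem toDualSpecht_surjective : Function.Surjective (toDualSpecht K l) :=
  (LinearMap.dualMap_surjective_of_injective (Submodule.injective_subtype _)).comp
    (tabloidForm_surjective K)

theorem toDualSpecht_eq_zero_iff {u : MonoidAlgebra K (BiTabloid l)} :
    toDualSpecht K l u = 0 ↔ ∀ t, tabloidForm K l u (polytabloid K t) = 0 :=
  ⟨fun h t => LinearMap.congr_fun h (spechtPolytabloid K t),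
    fun h => LinearMap.ext_on_range (span_spechtPolytabloid K) h⟩

/-- The linear map `M(λ) → S(λ')` with `{t} ↦ ± e_{t'}`, where the sign is that of `t` relative to
the reference bi-tableau `t₀`. It intertwines `M(λ)` with the twist of `S(λ')` by `sgn`. -/
noncomputable def conjLift (t₀ : BiTableau l) :
    MonoidAlgebra K (BiTabloid l) →ₗ[K] (spechtSub K l.conj).toSubmodule :=
  (tabloidBasis K l).constr K <|
    Quotient.lift (fun t => t₀.relSign t • spechtPolytabloid K t.conj) <| by
      rintro t _ ⟨σ, hσ, rfl⟩
      rw [← BiTableau.colGroup_conj] at hσ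
      rw [BiTableau.conj_smul, spechtPolytabloid_smul_of_mem_colGroup K hσ, BiTableau.relSign_smul,
        smul_smul, mul_right_comm, Int.units_mul_self, one_mul]

theorem conjLift_tabloid (t₀ t : BiTableau l) :
    conjLift K t₀ (tabloid K t) = t₀.relSign t • spechtPolytabloid K t.conj := by
  rw [conjLift, ← tabloidBasis_mk, Module.Basis.constr_basis, Quotient.lift_mk]

theorem conjLift_surjective (t₀ : BiTableau l) : Function.Surjective (conjLift K t₀) := by
  rw [← LinearMap.range_eq_top, eq_top_iff, ← span_spechtPolytabloid, Submodule.span_le]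
  rintro _ ⟨s, rfl⟩
  obtain ⟨t, rfl⟩ := BiTableau.conj_surjective s
  refine ⟨t₀.relSign t • tabloid K t, ?_⟩
  rw [LinearMap.map_smul_of_tower, conjLift_tabloid, smul_smul, Int.units_mul_self, one_smul]

theorem conjLift_permModule (t₀ : BiTableau l) (σ : W r) (v : MonoidAlgebra K (BiTabloid l)) :
    conjLift K t₀ (permModule K l σ v) = twist W.sgn (specht K l.conj) σ (conjLift K t₀ v) := by
  suffices h : conjLift K t₀ ∘ₗ permModule K l σ =
      twist W.sgn (specht K l.conj) σ ∘ₗ conjLift K t₀ from LinearMap.congr_fun h v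
  refine linearMap_ext_tabloid fun t => ?_
  rw [LinearMap.comp_apply, LinearMap.comp_apply, permModule_tabloid, conjLift_tabloid,
    conjLift_tabloid, twist_apply, LinearMap.map_smul_of_tower, specht_spechtPolytabloid,
    BiTableau.relSign_smul, BiTableau.conj_smul, mul_smul]

theorem tabloidForm_conjLift (t₀ t : BiTableau l) (v : MonoidAlgebra K (BiTabloid l)) :
    tabloidForm K l.conj (tabloid K t.conj) (conjLift K t₀ v) =
      t₀.relSign t • tabloidForm K l v (polytabloid K t) := by
  suffices h : tabloidForm K l.conj (tabloid K t.conj) ∘ₗ Submodule.subtype _ ∘ₗ conjLift K t₀ =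
      t₀.relSign t • (tabloidForm K l).flip (polytabloid K t) from LinearMap.congr_fun h v
  refine linearMap_ext_tabloid fun s => ?_
  obtain ⟨σ, rfl⟩ := MulAction.exists_smul_eq (W r) t s
  rw [LinearMap.comp_apply, LinearMap.comp_apply, conjLift_tabloid, BiTableau.relSign_smul,
    mul_comm, mul_smul]
  simp only [LinearMap.map_smul_of_tower]
  exact congrArg (t₀.relSign t • ·) (tabloidForm_smul_tabloid_polytabloid K σ t).symm

theorem conjLift_eq_zero_iff (t₀ : BiTableau l) {v : MonoidAlgebra K (BiTabloid l)} :
    conjLift K t₀ v = 0 ↔ ∀ t, tabloidForm K l v (polytabloid K t) = 0 := by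
  refine ⟨fun h t => ?_, fun h => Subtype.ext (eq_zero_of_tabloidForm_eq_zero fun s => ?_)⟩
  · rw [← smul_eq_zero_iff_eq (t₀.relSign t), ← tabloidForm_conjLift, h, Submodule.coe_zero,
      map_zero]
  · obtain ⟨t, rfl⟩ := BiTableau.conj_surjective s
    rw [tabloidForm_conjLift, h, smul_zero]

theorem nonempty_dualSpecht_equiv_twist_sgn_specht_conj (l : BiPartition r) :
    Nonempty ((dualSpecht K l).Equiv (twist W.sgn (specht K l.conj))) := by
  obtain ⟨t₀⟩ : Nonempty (BiTableau l) := inferInstance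
  let θ : (permModule K l).IntertwiningMap (twist W.sgn (specht K l.conj)) :=
    ⟨conjLift K t₀, fun σ => LinearMap.ext (conjLift_permModule K t₀ σ)⟩
  exact nonempty_equiv_of_eq_zero_iff (toDualSpecht K l) θ (toDualSpecht_surjective K)
    (conjLift_surjective K t₀) fun v =>
      (toDualSpecht_eq_zero_iff K).trans (conjLift_eq_zero_iff K t₀).symm

end Hyperoctahedral

theorem mainTheorem12 (K : Type*) [Field K] (r : ℕ) (l : Hyperoctahedral.BiPartition r) :
    Nonempty (Representation.Equiv
      (Hyperoctahedral.dualSpecht K l.conj)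
      ((Hyperoctahedral.specht K l).tprod
        (Hyperoctahedral.specht K (Hyperoctahedral.signShape r)))) := by
  open Hyperoctahedral in
  obtain ⟨dualEquivTwist⟩ : Nonempty ((dualSpecht K l.conj).Equiv (twist W.sgn (specht K l))) := by
    have h := nonempty_dualSpecht_equiv_twist_sgn_specht_conj K l.conj
    rwa [l.conj_conj] at h
  obtain ⟨twistEquivTensor⟩ := nonempty_twist_sgn_equiv_tprod_specht_signShape K (specht K l)
  exact ⟨dualEquivTwist.trans twistEquivTensor⟩
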